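/- Let $M=\mathbb{R}^4$ be the Engel group with coordinates $q=(x_1,x_2,y,z)$ and identity $q_0=(0,0,0,0)$, with the sub-Lorentzian structure for which $X_1=\partial_{x_1}-\frac{x_2}{2}\partial_y$ (timelike) and $X_2=\partial_{x_2}+\frac{x_1}{2}\partial_y+\frac{x_1^2+x_2^2}{2}\partial_z$ (spacelike) form an orthonormal frame. Let $C=\{\lambda=(\theta,c,\alpha)\in\mathbb{R}^3\}$ parametrize the initial covectors at $q_0$ of the spacelike normal extremals with $H=\frac12(-h_1^2+h_2^2)=\frac12$, $h_2>0$, via $h_1=\sinh\theta$, $h_2=\cosh\theta$, $h_3=c$, $h_4=\alpha$. The extremal with initial covector $\lambda$ is the solution of $$\dot x_1=-\sinh\theta,\quad \dot x_2=\cosh\theta,\quad \dot y=\tfrac12(x_2\sinh\theta+x_1\cosh\theta),\quad \dot z=\tfrac12(x_1^2+x_2^2)\cosh\theta,$$ $$\dot\theta=-c,\quad \dot c=-\alpha\sinh\theta,\quad \dot\alpha=0$$ with $(\theta,c,\alpha)(0)=\lambda$ and $q(0)=q_0$. Let $t_{\sup}(\lambda)\in(0,+\infty]$ be the supremum of the times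 up to which this solution exists, let $N=\{(\lambda,t)\in C\times\mathbb{R} : 0<t<t_{\sup}(\lambda)\}$, and let $\mathrm{Exp}(\lambda,t)=q(t)$ be the exponential mapping. For $(\lambda,t)\in N$ put $$\varepsilon^1(\lambda,t)=(\lambda^1,t),\qquad \lambda^1=(\theta(t),-c(t),\alpha),$$ where $(\theta(t),c(t),\alpha)$ is the covector at time $t$ of the extremal with initial covector $\lambda$, and define the Maxwell set $$\mathrm{MAX}^1=\{(\lambda,t)\in N : \lambda^1\neq\lambda,\ \mathrm{Exp}(\lambda^1,t)=\mathrm{Exp}(\lambda,t)\}.$$ Finally let $E=\frac{c^2}{2}-\alpha\cosh\theta$, $C_2=\{\lambda\in C : \alpha>0,\ E<-\alpha\}$ and $N_2=\{(\lambda,t)\in N : \lambda\in C_2\}$. **Proposition.** $\mathrm{MAX}^1\cap N_2=\emptyset$. -/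

import Mathlib

open Set

namespace EngelSpacelike

/-- A point `q = (x₁, x₂, y, z)` of the Engel group `M = ℝ⁴`. -/
@[ext]
structure Point where
  x₁ : ℝ
  x₂ : ℝ
  y : ℝ
  z : ℝ

/-- The identity `q₀ = (0, 0, 0, 0)` of the Engel group. -/
def Point.origin : Point := ⟨0, 0, 0, 0⟩

/-- An initial covector `λ = (θ, c, α)` of the set `C ≅ ℝ³`, that is, the covector at the identity
with `h₁ = sinh θ`, `h₂ = cosh θ`, `h₃ = c`, `h₄ = α`
(the part `h₂ > 0` of the level surface `H = (-h₁² + h₂²) / 2 = 1 / 2`). -/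
@[ext]
structure Costate where
  θ : ℝ
  c : ℝ
  α : ℝ

/-- The energy integral `E = c² / 2 - α cosh θ` of the vertical subsystem. -/
noncomputable def Costate.energy (l : Costate) : ℝ := l.c ^ 2 / 2 - l.α * Real.cosh l.θ

/-- `IsExtremal T l₀ l q`: on the time interval `[0, T]` the pair `t ↦ (l t, q t)` is the spacelike
normal extremal with initial covector `l₀` and initial point `q₀`. It solves the Hamiltonian system
of the Hamiltonian `H = (-h₁² + h₂²) / 2`, where `hᵢ = ⟨ξ, Xᵢ⟩` for the orthonormal frame
`X₁ = ∂/∂x₁ - (x₂ / 2) ∂/∂y`, `X₂ = ∂/∂x₂ + (x₁ / 2) ∂/∂y + ((x₁² + x₂²) / 2) ∂/∂z`,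
written in the coordinates `(θ, c, α, x₁, x₂, y, z)` of the level surface `H = 1 / 2`, `h₂ > 0`;
in particular `dq/dt = -sinh θ X₁(q) + cosh θ X₂(q)`. -/
structure IsExtremal (T : ℝ) (l₀ : Costate) (l : ℝ → Costate) (q : ℝ → Point) : Prop where
  costate_zero : l 0 = l₀
  point_zero : q 0 = Point.origin
  deriv_x₁ : ∀ t ∈ Icc 0 T,
    HasDerivWithinAt (fun s => (q s).x₁) (-Real.sinh (l t).θ) (Icc 0 T) t
  deriv_x₂ : ∀ t ∈ Icc 0 T,
    HasDerivWithinAt (fun s => (q s).x₂) (Real.cosh (l t).θ) (Icc 0 T) t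
  deriv_y : ∀ t ∈ Icc 0 T,
    HasDerivWithinAt (fun s => (q s).y)
      (((q t).x₂ * Real.sinh (l t).θ + (q t).x₁ * Real.cosh (l t).θ) / 2) (Icc 0 T) t
  deriv_z : ∀ t ∈ Icc 0 T,
    HasDerivWithinAt (fun s => (q s).z)
      (((q t).x₁ ^ 2 + (q t).x₂ ^ 2) / 2 * Real.cosh (l t).θ) (Icc 0 T) t
  deriv_θ : ∀ t ∈ Icc 0 T, HasDerivWithinAt (fun s => (l s).θ) (-(l t).c) (Icc 0 T) t
  deriv_c : ∀ t ∈ Icc 0 T,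
    HasDerivWithinAt (fun s => (l s).c) (-(l t).α * Real.sinh (l t).θ) (Icc 0 T) t
  deriv_α : ∀ t ∈ Icc 0 T, HasDerivWithinAt (fun s => (l s).α) 0 (Icc 0 T) t

/-- The right-hand side of the system, on `ℝ⁷` with coordinates `(θ, c, α, x₁, x₂, y, z)`. -/
noncomputable def field (w : ℝ × ℝ × ℝ × ℝ × ℝ × ℝ × ℝ) : ℝ × ℝ × ℝ × ℝ × ℝ × ℝ × ℝ :=
  (-w.2.1, -w.2.2.1 * Real.sinh w.1, 0, -Real.sinh w.1, Real.cosh w.1,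
    (w.2.2.2.2.1 * Real.sinh w.1 + w.2.2.2.1 * Real.cosh w.1) / 2,
    (w.2.2.2.1 ^ 2 + w.2.2.2.2.1 ^ 2) / 2 * Real.cosh w.1)

theorem field_locallyLipschitz : LocallyLipschitz field := by
  have : ContDiff ℝ 1 field := by
    unfold field
    have := @Real.contDiff_sinh 1
    have := @Real.contDiff_cosh 1
    fun_prop
  exact this.locallyLipschitz

/-- The pair `(l, q)` as a curve in `ℝ⁷`. -/
def curve (l : ℝ → Costate) (q : ℝ → Point) (t : ℝ) : ℝ × ℝ × ℝ × ℝ × ℝ × ℝ × ℝ :=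
  ((l t).θ, (l t).c, (l t).α, (q t).x₁, (q t).x₂, (q t).y, (q t).z)

theorem IsExtremal.hasDerivWithinAt {T : ℝ} {l₀ : Costate} {l : ℝ → Costate} {q : ℝ → Point}
    (h : IsExtremal T l₀ l q) (t : ℝ) (ht : t ∈ Icc 0 T) :
    HasDerivWithinAt (curve l q) (field (curve l q t)) (Icc 0 T) t :=
  (h.deriv_θ t ht).prodMk ((h.deriv_c t ht).prodMk ((h.deriv_α t ht).prodMk
    ((h.deriv_x₁ t ht).prodMk ((h.deriv_x₂ t ht).prodMk
      ((h.deriv_y t ht).prodMk (h.deriv_z t ht))))))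

/-- An extremal is determined by its initial covector. -/
theorem IsExtremal.unique {T : ℝ} {l₀ : Costate} {l l' : ℝ → Costate} {q q' : ℝ → Point}
    (h : IsExtremal T l₀ l q) (h' : IsExtremal T l₀ l' q') (t : ℝ) (ht : t ∈ Icc 0 T) :
    l t = l' t ∧ q t = q' t := by
  have hc : ContinuousOn (curve l q) (Icc 0 T) := fun s hs =>
    (h.hasDerivWithinAt s hs).continuousWithinAt
  have hc' : ContinuousOn (curve l' q') (Icc 0 T) := fun s hs =>
    (h'.hasDerivWithinAt s hs).continuousWithinAt
  have hK : IsCompact (curve l q '' Icc 0 T ∪ curve l' q' '' Icc 0 T) :=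
    (isCompact_Icc.image_of_continuousOn hc).union (isCompact_Icc.image_of_continuousOn hc')
  obtain ⟨K, hL⟩ := (field_locallyLipschitz.locallyLipschitzOn).exists_lipschitzOnWith_of_compact hK
  have key := ODE_solution_unique_of_mem_Icc_right (v := fun _ => field)
    (s := fun _ => curve l q '' Icc 0 T ∪ curve l' q' '' Icc 0 T) (K := K)
    (fun _ _ => hL) hc
    (fun s hs => (h.hasDerivWithinAt s (mem_Icc_of_Ico hs)).mono_of_mem_nhdsWithin
      (Icc_mem_nhdsGE_of_mem hs))
    (fun s hs => Or.inl (mem_image_of_mem _ (mem_Icc_of_Ico hs))) hc'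
    (fun s hs => (h'.hasDerivWithinAt s (mem_Icc_of_Ico hs)).mono_of_mem_nhdsWithin
      (Icc_mem_nhdsGE_of_mem hs))
    (fun s hs => Or.inr (mem_image_of_mem _ (mem_Icc_of_Ico hs)))
    (by simp [curve, h.costate_zero, h'.costate_zero, h.point_zero, h'.point_zero])
  have e := key ht
  simp only [curve, Prod.mk.injEq] at e
  obtain ⟨e1, e2, e3, e4, e5, e6, e7⟩ := e
  exact ⟨Costate.ext e1 e2 e3, Point.ext e4 e5 e6 e7⟩

/-- The extremal with initial covector `l₀` exists on the whole interval `[0, T]`. -/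
def ExistsUpTo (l₀ : Costate) (T : ℝ) : Prop :=
  ∃ p : (ℝ → Costate) × (ℝ → Point), IsExtremal T l₀ p.1 p.2

/-- The upper bound `t_sup(λ) ∈ [0, +∞]` of the time parameter: the supremum of the times up to
which the extremal with initial covector `λ` exists. -/
noncomputable def tSup (l₀ : Costate) : EReal :=
  sSup {s : EReal | ∃ T : ℝ, 0 ≤ T ∧ ExistsUpTo l₀ T ∧ s = (T : EReal)}

/-- The domain `N = {(λ, t) ∈ C × ℝ₊ | t ∈ (0, t_sup(λ))}` of the exponential mapping. -/
def domain : Set (Costate × ℝ) := {ν | 0 < ν.2 ∧ (ν.2 : EReal) < tSup ν.1}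

open Classical in
/-- The flow `e^{t H_v}` of `H_v = -c ∂/∂θ - α sinh θ ∂/∂c`, the vertical part of the Hamiltonian
vector field: the covector at time `t` of the extremal with initial covector `l₀`
(a dummy value if that extremal does not exist up to time `t`). -/
noncomputable def vertFlow (t : ℝ) (l₀ : Costate) : Costate :=
  if h : ExistsUpTo l₀ t then h.choose.1 t else l₀

open Classical in
/-- The exponential mapping `Exp(λ, t) = q(t)`: the point at time `t` of the extremal with initial
covector `λ` (a dummy value if that extremal does not exist up to time `t`). -/
noncomputable def Exp (ν : Costate × ℝ) : Point :=
  if h : ExistsUpTo ν.1 ν.2 then h.choose.2 ν.2 else Point.origin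

theorem vertFlow_eq {t : ℝ} (ht : 0 ≤ t) {l₀ : Costate} {l : ℝ → Costate} {q : ℝ → Point}
    (h : IsExtremal t l₀ l q) : vertFlow t l₀ = l t := by
  have hex : ExistsUpTo l₀ t := ⟨(l, q), h⟩
  rw [vertFlow, dif_pos hex]
  exact (hex.choose_spec.unique h t ⟨ht, le_rfl⟩).1

theorem Exp_eq {t : ℝ} (ht : 0 ≤ t) {l₀ : Costate} {l : ℝ → Costate} {q : ℝ → Point}
    (h : IsExtremal t l₀ l q) : Exp (l₀, t) = q t := by
  have hex : ExistsUpTo l₀ t := ⟨(l, q), h⟩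
  rw [Exp, dif_pos hex]
  exact (hex.choose_spec.unique h t ⟨ht, le_rfl⟩).2

/-- The reflection `ε¹ : C → C`, `(θ, c, α) ↦ (θ, -c, α)`. -/
def eps1 (l : Costate) : Costate := ⟨l.θ, -l.c, l.α⟩

/-- The action `ε¹(λ, t) = (ε¹ ∘ e^{t H_v}(λ), t)` of the reflection on pairs `(λ, t)`.
It sends the vertical trajectory `(θ(s), c(s), α)`, `s ∈ [0, t]`, to the vertical trajectory
`(θ(t - s), -c(t - s), α)`, `s ∈ [0, t]`. -/
noncomputable def eps1Domain (ν : Costate × ℝ) : Costate × ℝ :=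
  (eps1 (vertFlow ν.2 ν.1), ν.2)

/-- The Maxwell set `MAX¹ = {(λ, t) ∈ N | λ¹ ≠ λ, Exp(λ¹, t) = Exp(λ, t)}`, where `λ¹` is the first
component of `ε¹(λ, t)`. -/
def MAX1 : Set (Costate × ℝ) :=
  {ν | ν ∈ domain ∧ (eps1Domain ν).1 ≠ ν.1 ∧ Exp (eps1Domain ν) = Exp ν}

/-- The set `C₂ = {λ ∈ C | α > 0, E < -α}`. -/
def C2 : Set Costate := {l | 0 < l.α ∧ l.energy < -l.α}

/-- The set `N₂ = {(λ, t) ∈ C₂ × ℝ₊ | t ∈ (0, t_sup(λ))}`. -/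
def N2 : Set (Costate × ℝ) := {ν | ν.1 ∈ C2 ∧ ν ∈ domain}

end EngelSpacelike

namespace EngelSpacelike

/-! Reversing an extremal in time and translating it back to the identity gives the extremal with
initial covector `λ¹`, and its endpoint has `y` of opposite sign. Equal endpoints therefore force
`y(t) = 0`. Integrating, `α y(t) = -F(t)`, where `F = (c + c(0)) / 2 * (K - K(0)) + sinh θ - sinh
θ(0)` and `K = x₂`.

It remains to find the zeros of `F`. Since `E < -α`, `θ` never vanishes, and up to symmetry `θ > 0`,
so `c` strictly decreases. If `c(0) + c(T) < 0`, then `F(T) < 0` (`area_neg`, based on `chord_neg`);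
time reversal gives `F(T) > 0` for a positive sum. Hence `F(T) = 0` forces `c(T) = -c(0)`, then
`sinh θ(T) = sinh θ(0)`, that is `λ¹ = λ`. -/

/-- The vertical subsystem `θ' = -c`, `c' = -α sinh θ` with constant `α`, together with
`K' = cosh θ`, on the interval `[0, T]`. -/
structure VerticalSolution (α T : ℝ) (θ c K : ℝ → ℝ) : Prop where
  deriv_θ : ∀ t ∈ Icc 0 T, HasDerivWithinAt θ (-c t) (Icc 0 T) t
  deriv_c : ∀ t ∈ Icc 0 T, HasDerivWithinAt c (-α * Real.sinh (θ t)) (Icc 0 T) t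
  deriv_K : ∀ t ∈ Icc 0 T, HasDerivWithinAt K (Real.cosh (θ t)) (Icc 0 T) t

/-! ### Calculus on a closed interval. -/

theorem eq_zero_of_hasDerivWithinAt_zero {T : ℝ} {f : ℝ → ℝ}
    (h : ∀ t ∈ Icc 0 T, HasDerivWithinAt f 0 (Icc 0 T) t) {t : ℝ} (ht : t ∈ Icc 0 T) :
    f t = f 0 :=
  constant_of_has_deriv_right_zero (fun s hs => (h s hs).continuousWithinAt)
    (fun s hs => (h s (mem_Icc_of_Ico hs)).mono_of_mem_nhdsWithin (Icc_mem_nhdsGE_of_mem hs)) t ht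

theorem strictAntiOn_of_hasDerivWithinAt_Icc {a b A B : ℝ} {f f' : ℝ → ℝ}
    (hsub : Icc a b ⊆ Icc A B)
    (h : ∀ t ∈ Icc A B, HasDerivWithinAt f (f' t) (Icc A B) t)
    (hneg : ∀ t ∈ Ioo a b, f' t < 0) : StrictAntiOn f (Icc a b) := by
  refine strictAntiOn_of_hasDerivWithinAt_neg (f' := f') (convex_Icc a b)
    (fun s hs => ((h s (hsub hs)).continuousWithinAt).mono hsub) (fun s hs => ?_) (fun s hs => ?_)
  · exact (h s (hsub (interior_subset hs))).mono (interior_subset.trans hsub)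
  · rw [interior_Icc] at hs
    exact hneg s hs

theorem hasDerivWithinAt_comp_sub {T f' : ℝ} {f : ℝ → ℝ} {t : ℝ}
    (h : HasDerivWithinAt f f' (Icc 0 T) (T - t)) :
    HasDerivWithinAt (fun s => f (T - s)) (-f') (Icc 0 T) t := by
  have h1 : HasDerivWithinAt (fun s => T - s) (-1) (Icc 0 T) t :=
    (hasDerivWithinAt_id t _).const_sub T
  have h2 := HasDerivWithinAt.comp t h h1 (fun s hs => ⟨by linarith [hs.2], by linarith [hs.1]⟩)
  simpa [Function.comp_def] using h2

theorem sub_mem_Icc {T t : ℝ} (ht : t ∈ Icc 0 T) : T - t ∈ Icc 0 T :=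
  ⟨by linarith [ht.2], by linarith [ht.1]⟩

/-! ### The vertical subsystem and the sign of `F`. -/

namespace VerticalSolution

variable {α T : ℝ} {θ c K : ℝ → ℝ}

/-- `K` changes sign so that its derivative stays `cosh θ`; both `F(T)` and `c(0) + c(T)` change
sign. -/
theorem reverse (h : VerticalSolution α T θ c K) :
    VerticalSolution α T (fun s => θ (T - s)) (fun s => -c (T - s)) (fun s => -K (T - s)) where
  deriv_θ t ht := hasDerivWithinAt_comp_sub (h.deriv_θ _ (sub_mem_Icc ht))
  deriv_c t ht :=
    (hasDerivWithinAt_comp_sub (h.deriv_c _ (sub_mem_Icc ht))).neg.congr_deriv (by simp)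
  deriv_K t ht :=
    (hasDerivWithinAt_comp_sub (h.deriv_K _ (sub_mem_Icc ht))).neg.congr_deriv (by simp)

theorem neg (h : VerticalSolution α T θ c K) :
    VerticalSolution α T (fun s => -θ s) (fun s => -c s) K where
  deriv_θ t ht := (h.deriv_θ t ht).neg
  deriv_c t ht := (h.deriv_c t ht).neg.congr_deriv (by simp)
  deriv_K t ht := by simpa using h.deriv_K t ht

theorem energy_eq (h : VerticalSolution α T θ c K) {t : ℝ} (ht : t ∈ Icc 0 T) :
    c t ^ 2 / 2 - α * Real.cosh (θ t) = c 0 ^ 2 / 2 - α * Real.cosh (θ 0) := by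
  refine eq_zero_of_hasDerivWithinAt_zero
    (f := fun s => c s ^ 2 / 2 - α * Real.cosh (θ s)) (fun s hs => ?_) ht
  refine HasDerivWithinAt.congr_deriv
    ((((h.deriv_c s hs).pow 2).div_const 2).sub ((h.deriv_θ s hs).cosh.const_mul α)) ?_
  simp
  ring

theorem strictAntiOn_c (h : VerticalSolution α T θ c K) (hα : 0 < α)
    (hθ : ∀ t ∈ Icc 0 T, 0 < θ t) : StrictAntiOn c (Icc 0 T) :=
  strictAntiOn_of_hasDerivWithinAt_Icc subset_rfl h.deriv_c fun t ht => by
    have := mul_pos hα (Real.sinh_pos_iff.2 (hθ t (Ioo_subset_Icc_self ht)))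
    linarith

theorem lt_of_sq_lt (h : VerticalSolution α T θ c K) (hα : 0 < α)
    (hθ : ∀ t ∈ Icc 0 T, 0 < θ t) {s r : ℝ} (hs : s ∈ Icc 0 T) (hr : r ∈ Icc 0 T)
    (hc : c s ^ 2 < c r ^ 2) : θ s < θ r := by
  have h1 := h.energy_eq hs
  have h2 := h.energy_eq hr
  have h3 : Real.cosh (θ s) < Real.cosh (θ r) := by
    refine lt_of_mul_lt_mul_left (a := α) ?_ hα.le
    linarith
  rwa [Real.cosh_lt_cosh, abs_of_pos (hθ s hs), abs_of_pos (hθ r hr)] at h3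

theorem eq_of_sq_eq (h : VerticalSolution α T θ c K) (hα : 0 < α)
    (hθ : ∀ t ∈ Icc 0 T, 0 < θ t) {s r : ℝ} (hs : s ∈ Icc 0 T) (hr : r ∈ Icc 0 T)
    (hc : c s ^ 2 = c r ^ 2) : θ s = θ r := by
  have h1 := h.energy_eq hs
  have h2 := h.energy_eq hr
  have h3 : Real.cosh (θ s) = Real.cosh (θ r) := by
    refine mul_left_cancel₀ hα.ne' ?_
    linarith
  exact Real.cosh_injOn (hθ s hs).le (hθ r hr).le h3

/-- The velocity direction at a time `r` where `|c|` exceeds all its previous values is steeper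
than the chord. -/
theorem chord_neg (h : VerticalSolution α T θ c K) (hα : 0 < α)
    (hθ : ∀ t ∈ Icc 0 T, 0 < θ t) {r : ℝ} (hr : r ∈ Icc 0 T) (hr0 : 0 < r)
    (hc : c 0 + c r < 0) :
    Real.cosh (θ r) * (c 0 - c r) - α * Real.sinh (θ r) * (K r - K 0) < 0 := by
  have hsub : Icc 0 r ⊆ Icc 0 T := Icc_subset_Icc_right hr.2
  have key := strictAntiOn_of_hasDerivWithinAt_Icc hsub
    (f := fun s => Real.cosh (θ r) * (c 0 - c s) - α * Real.sinh (θ r) * (K s - K 0))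
    -- Freezing the direction at `r` turns the derivative into a sinh of a difference, by the
    -- subtraction formula.
    (f' := fun s => α * Real.sinh (θ s - θ r)) (fun s hs => by
      refine HasDerivWithinAt.congr_deriv
        ((((h.deriv_c s hs).const_sub (c 0)).const_mul (Real.cosh (θ r))).sub
        (((h.deriv_K s hs).sub_const (K 0)).const_mul (α * Real.sinh (θ r)))) ?_
      rw [Real.sinh_sub]
      ring) (fun s hs => by
      have hsT := hsub (Ioo_subset_Icc_self hs)
      have hanti := h.strictAntiOn_c hα hθ
      have h0 : (0 : ℝ) ∈ Icc 0 T := ⟨le_rfl, hr.1.trans hr.2⟩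
      have h1 : c r < c s := hanti hsT hr hs.2
      have h2 : c s < c 0 := hanti h0 hsT hs.1
      have h3 : θ s < θ r := h.lt_of_sq_lt hα hθ hsT hr (by nlinarith)
      exact mul_neg_of_pos_of_neg hα (Real.sinh_neg_iff.2 (by linarith)))
    (left_mem_Icc.2 hr0.le) (right_mem_Icc.2 hr0.le) hr0
  simpa using key

/-- Half the quantity of `chord_neg` is the derivative of `F`, so `F` decreases once `c 0 + c s <
0`; it suffices to find a zero of `F` from which this holds. -/
theorem area_neg (h : VerticalSolution α T θ c K) (hα : 0 < α) (hT : 0 < T)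
    (hθ : ∀ t ∈ Icc 0 T, 0 < θ t) (hc : c 0 + c T < 0) :
    (c T + c 0) / 2 * (K T - K 0) + Real.sinh (θ T) - Real.sinh (θ 0) < 0 := by
  have h0 : (0 : ℝ) ∈ Icc 0 T := left_mem_Icc.2 hT.le
  have hT' : T ∈ Icc 0 T := right_mem_Icc.2 hT.le
  have hanti := h.strictAntiOn_c hα hθ
  have hcT : c T < c 0 := hanti h0 hT' hT
  obtain ⟨τ, hτ, hFτ, hcτ⟩ : ∃ τ ∈ Ico 0 T,
      (c τ + c 0) / 2 * (K τ - K 0) + Real.sinh (θ τ) - Real.sinh (θ 0) = 0 ∧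
      c 0 + c τ ≤ 0 := by
    -- If `c 0 > 0`, the zero is the mirror time where `c τ = -c 0`: there `θ τ = θ 0` by energy.
    rcases le_total (c 0) 0 with hc0 | hc0
    · exact ⟨0, ⟨le_rfl, hT⟩, by simp, by linarith⟩
    · obtain ⟨τ, hτ, he⟩ := intermediate_value_Icc' hT.le
        (fun s hs => (h.deriv_c s hs).continuousWithinAt)
        (show -c 0 ∈ Icc (c T) (c 0) from ⟨by linarith, by linarith⟩)
      have hne : τ ≠ T := by
        rintro rfl
        linarith
      have hθτ : θ τ = θ 0 := h.eq_of_sq_eq hα hθ hτ h0 (by rw [he]; ring)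
      exact ⟨τ, ⟨hτ.1, lt_of_le_of_ne hτ.2 hne⟩, by rw [hθτ, he]; ring, by linarith⟩
  have hsub : Icc τ T ⊆ Icc 0 T := Icc_subset_Icc_left hτ.1
  have key := strictAntiOn_of_hasDerivWithinAt_Icc hsub
    (f := fun s => (c s + c 0) / 2 * (K s - K 0) + Real.sinh (θ s) - Real.sinh (θ 0))
    (f' := fun s =>
      (Real.cosh (θ s) * (c 0 - c s) - α * Real.sinh (θ s) * (K s - K 0)) / 2)
    (fun s hs => by
      refine HasDerivWithinAt.congr_deriv (((((h.deriv_c s hs).add_const (c 0)).div_const 2).mul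
        ((h.deriv_K s hs).sub_const (K 0))).add (h.deriv_θ s hs).sinh
        |>.sub_const (Real.sinh (θ 0))) ?_
      ring) (fun s hs => by
      have hsT := hsub (Ioo_subset_Icc_self hs)
      have h1 : c s < c τ := hanti (mem_Icc_of_Ico hτ) hsT hs.1
      have := h.chord_neg hα hθ hsT (hτ.1.trans_lt hs.1) (by linarith)
      linarith)
    (left_mem_Icc.2 hτ.2.le) (right_mem_Icc.2 hτ.2.le) hτ.2
  simp only [hFτ] at key
  exact key

theorem c_add_eq_zero_of_pos (h : VerticalSolution α T θ c K) (hα : 0 < α) (hT : 0 < T)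
    (hθ : ∀ t ∈ Icc 0 T, 0 < θ t)
    (hF : (c T + c 0) / 2 * (K T - K 0) + Real.sinh (θ T) - Real.sinh (θ 0) = 0) :
    c 0 + c T = 0 := by
  rcases lt_trichotomy (c 0 + c T) 0 with hlt | heq | hgt
  · exact absurd hF (h.area_neg hα hT hθ hlt).ne
  · exact heq
  · have := h.reverse.area_neg hα hT (fun t ht => hθ _ (sub_mem_Icc ht))
      (by simp only [sub_zero, sub_self]; linarith)
    simp only [sub_zero, sub_self] at this
    nlinarith

theorem endpoints_eq (h : VerticalSolution α T θ c K) (hα : 0 < α) (hT : 0 < T)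
    (hE : c 0 ^ 2 / 2 - α * Real.cosh (θ 0) < -α)
    (hF : (c T + c 0) / 2 * (K T - K 0) + Real.sinh (θ T) - Real.sinh (θ 0) = 0) :
    θ T = θ 0 ∧ -c T = c 0 := by
  have h0 : (0 : ℝ) ∈ Icc 0 T := left_mem_Icc.2 hT.le
  have hT' : T ∈ Icc 0 T := right_mem_Icc.2 hT.le
  -- At a zero of `θ` the energy would be at least `-α`.
  have hne : ∀ t ∈ Icc 0 T, θ t ≠ 0 := fun t ht he => by
    have := h.energy_eq ht
    rw [he, Real.cosh_zero] at this
    nlinarith [sq_nonneg (c t)]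
  have hcont : ContinuousOn θ (Icc 0 T) := fun s hs => (h.deriv_θ s hs).continuousWithinAt
  have hsum : c 0 + c T = 0 := by
    rcases lt_or_gt_of_ne (hne 0 h0) with hneg | hpos
    · have hθ : ∀ t ∈ Icc 0 T, 0 < -θ t := fun t ht => by
        by_contra hcon
        obtain ⟨s, hs, he⟩ := intermediate_value_Icc ht.1
          (hcont.mono (Icc_subset_Icc_right ht.2))
          (show (0 : ℝ) ∈ Icc (θ 0) (θ t) from ⟨hneg.le, by linarith⟩)
        exact hne s (Icc_subset_Icc_right ht.2 hs) he
      have := h.neg.c_add_eq_zero_of_pos hα hT hθ (by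
        simp only [Real.sinh_neg]
        linarith)
      linarith
    · have hθ : ∀ t ∈ Icc 0 T, 0 < θ t := fun t ht => by
        by_contra hcon
        obtain ⟨s, hs, he⟩ := intermediate_value_Icc' ht.1
          (hcont.mono (Icc_subset_Icc_right ht.2))
          (show (0 : ℝ) ∈ Icc (θ t) (θ 0) from ⟨by linarith, hpos.le⟩)
        exact hne s (Icc_subset_Icc_right ht.2 hs) he
      exact h.c_add_eq_zero_of_pos hα hT hθ hF
  refine ⟨Real.sinh_injective ?_, by linarith⟩
  rw [show c T + c 0 = 0 by linarith] at hF
  linarith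

end VerticalSolution

/-! ### First integrals and time reversal of extremals. -/

namespace IsExtremal

variable {T : ℝ} {l₀ : Costate} {l : ℝ → Costate} {q : ℝ → Point}

theorem mono (h : IsExtremal T l₀ l q) {t : ℝ} (ht : t ≤ T) : IsExtremal t l₀ l q :=
  have hsub : Icc 0 t ⊆ Icc 0 T := Icc_subset_Icc_right ht
  { costate_zero := h.costate_zero
    point_zero := h.point_zero
    deriv_x₁ := fun s hs => (h.deriv_x₁ s (hsub hs)).mono hsub
    deriv_x₂ := fun s hs => (h.deriv_x₂ s (hsub hs)).mono hsub
    deriv_y := fun s hs => (h.deriv_y s (hsub hs)).mono hsub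
    deriv_z := fun s hs => (h.deriv_z s (hsub hs)).mono hsub
    deriv_θ := fun s hs => (h.deriv_θ s (hsub hs)).mono hsub
    deriv_c := fun s hs => (h.deriv_c s (hsub hs)).mono hsub
    deriv_α := fun s hs => (h.deriv_α s (hsub hs)).mono hsub }

theorem α_eq (h : IsExtremal T l₀ l q) {t : ℝ} (ht : t ∈ Icc 0 T) : (l t).α = l₀.α := by
  rw [← h.costate_zero]
  exact eq_zero_of_hasDerivWithinAt_zero (f := fun s => (l s).α) h.deriv_α ht

theorem verticalSolution (h : IsExtremal T l₀ l q) :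
    VerticalSolution l₀.α T (fun s => (l s).θ) (fun s => (l s).c) (fun s => (q s).x₂) where
  deriv_θ := h.deriv_θ
  deriv_c t ht := by
    rw [← h.α_eq ht]
    exact h.deriv_c t ht
  deriv_K := h.deriv_x₂

theorem α_mul_x₁ (h : IsExtremal T l₀ l q) {t : ℝ} (ht : t ∈ Icc 0 T) :
    l₀.α * (q t).x₁ = (l t).c - (l 0).c := by
  have := eq_zero_of_hasDerivWithinAt_zero (f := fun s => l₀.α * (q s).x₁ - (l s).c)
    (fun s hs => by
      refine HasDerivWithinAt.congr_deriv
        (((h.deriv_x₁ s hs).const_mul l₀.α).sub (h.verticalSolution.deriv_c s hs)) ?_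
      ring) ht
  simp only [h.point_zero, Point.origin] at this
  linarith

theorem α_mul_y (h : IsExtremal T l₀ l q) {t : ℝ} (ht : t ∈ Icc 0 T) :
    l₀.α * (q t).y = -(((l t).c + (l 0).c) / 2 * ((q t).x₂ - (q 0).x₂)
      + Real.sinh (l t).θ - Real.sinh (l 0).θ) := by
  have := eq_zero_of_hasDerivWithinAt_zero
    (f := fun s => l₀.α * (q s).y + ((l s).c + (l 0).c) / 2 * (q s).x₂ + Real.sinh (l s).θ)
    (fun s hs => by
      refine HasDerivWithinAt.congr_deriv ((((h.deriv_y s hs).const_mul l₀.α).add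
        ((((h.verticalSolution.deriv_c s hs).add_const (l 0).c).div_const 2).mul
          (h.deriv_x₂ s hs))).add (h.deriv_θ s hs).sinh) ?_
      linear_combination (Real.cosh (l s).θ / 2) * h.α_mul_x₁ hs) ht
  simp only [h.point_zero, Point.origin] at this ⊢
  linarith

/-- The projection to the Engel group of the time-reversed extremal. -/
noncomputable def reversePoint (T : ℝ) (q : ℝ → Point) (s : ℝ) : Point where
  x₁ := (q T).x₁ - (q (T - s)).x₁
  x₂ := (q T).x₂ - (q (T - s)).x₂
  y := (q (T - s)).y - (q T).y
    + ((q T).x₂ * (q (T - s)).x₁ - (q T).x₁ * (q (T - s)).x₂) / 2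
  -- Expand the square in `z'`: `x₁ cosh θ` has primitive `y + x₁ x₂ / 2`, and `x₂ cosh θ` has
  -- primitive `x₂² / 2`.
  z := ((q T).x₁ ^ 2 + (q T).x₂ ^ 2) / 2 * ((q T).x₂ - (q (T - s)).x₂)
    - ((q T).x₁ * ((q T).y + (q T).x₁ * (q T).x₂ / 2) + (q T).x₂ * ((q T).x₂ ^ 2 / 2)
      - ((q T).x₁ * ((q (T - s)).y + (q (T - s)).x₁ * (q (T - s)).x₂ / 2)
        + (q T).x₂ * ((q (T - s)).x₂ ^ 2 / 2)))
    + ((q T).z - (q (T - s)).z)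

theorem reverse (h : IsExtremal T l₀ l q) :
    IsExtremal T (eps1 (l T)) (fun s => eps1 (l (T - s))) (reversePoint T q) where
  costate_zero := by simp
  point_zero := by
    simp only [reversePoint, Point.origin, sub_zero, sub_self, mul_zero, zero_add]
    ext <;> ring
  deriv_x₁ t ht := by
    have h1 := hasDerivWithinAt_comp_sub (h.deriv_x₁ _ (sub_mem_Icc ht))
    simpa [reversePoint, eps1] using h1.const_sub (q T).x₁
  deriv_x₂ t ht := by
    have h2 := hasDerivWithinAt_comp_sub (h.deriv_x₂ _ (sub_mem_Icc ht))
    simpa [reversePoint, eps1] using h2.const_sub (q T).x₂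
  deriv_y t ht := by
    have h1 := hasDerivWithinAt_comp_sub (h.deriv_x₁ _ (sub_mem_Icc ht))
    have h2 := hasDerivWithinAt_comp_sub (h.deriv_x₂ _ (sub_mem_Icc ht))
    have h3 := hasDerivWithinAt_comp_sub (h.deriv_y _ (sub_mem_Icc ht))
    refine HasDerivWithinAt.congr_deriv ((h3.sub_const (q T).y).add
      (((h1.const_mul (q T).x₂).sub (h2.const_mul (q T).x₁)).div_const 2)) ?_
    simp only [reversePoint, eps1]
    ring
  deriv_z t ht := by
    have h1 := hasDerivWithinAt_comp_sub (h.deriv_x₁ _ (sub_mem_Icc ht))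
    have h2 := hasDerivWithinAt_comp_sub (h.deriv_x₂ _ (sub_mem_Icc ht))
    have h3 := hasDerivWithinAt_comp_sub (h.deriv_y _ (sub_mem_Icc ht))
    have h4 := hasDerivWithinAt_comp_sub (h.deriv_z _ (sub_mem_Icc ht))
    refine HasDerivWithinAt.congr_deriv
      ((((h2.const_sub (q T).x₂).const_mul (((q T).x₁ ^ 2 + (q T).x₂ ^ 2) / 2)).sub
      ((((h3.add ((h1.mul h2).div_const 2)).const_mul (q T).x₁).add
        (((h2.pow 2).div_const 2).const_mul (q T).x₂)).const_sub
        ((q T).x₁ * ((q T).y + (q T).x₁ * (q T).x₂ / 2) + (q T).x₂ * ((q T).x₂ ^ 2 / 2)))).add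
      (h4.const_sub (q T).z)) ?_
    simp only [reversePoint, eps1]
    push_cast
    ring
  deriv_θ t ht := by
    simpa [eps1] using hasDerivWithinAt_comp_sub (h.deriv_θ _ (sub_mem_Icc ht))
  deriv_c t ht :=
    (hasDerivWithinAt_comp_sub (h.deriv_c _ (sub_mem_Icc ht))).neg.congr_deriv (by simp [eps1])
  deriv_α t ht := by
    simpa [eps1] using hasDerivWithinAt_comp_sub (h.deriv_α _ (sub_mem_Icc ht))

end IsExtremal

/-! ### Absence of Maxwell points. -/

theorem existsUpTo_of_mem_domain {l₀ : Costate} {t : ℝ} (h : (l₀, t) ∈ domain) :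
    ExistsUpTo l₀ t := by
  obtain ⟨_, ⟨T, _, ⟨p, hp⟩, rfl⟩, hlt⟩ := lt_sSup_iff.1 h.2
  exact ⟨p, hp.mono (EReal.coe_lt_coe_iff.1 hlt).le⟩

theorem eps1Domain_fst_eq {l₀ : Costate} {t : ℝ} (h : (l₀, t) ∈ domain)
    (hC : l₀ ∈ C2) (hExp : Exp (eps1Domain (l₀, t)) = Exp (l₀, t)) :
    (eps1Domain (l₀, t)).1 = l₀ := by
  obtain ⟨⟨l, q⟩, (hq : IsExtremal t l₀ l q)⟩ := existsUpTo_of_mem_domain h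
  have ht : 0 < t := h.1
  have htt : t ∈ Icc 0 t := right_mem_Icc.2 ht.le
  have hflow : vertFlow t l₀ = l t := vertFlow_eq ht.le hq
  simp only [eps1Domain, hflow] at hExp ⊢
  rw [Exp_eq ht.le hq, Exp_eq ht.le hq.reverse] at hExp
  -- At the final time the reversed curve has `y`-coordinate `-(q t).y`.
  have hy : (q t).y = 0 := by
    have := congrArg Point.y hExp
    simp only [IsExtremal.reversePoint, sub_self, hq.point_zero, Point.origin] at this
    linarith
  have hF := hq.α_mul_y htt
  rw [hy] at hF
  obtain ⟨h1, h2⟩ := hq.verticalSolution.endpoints_eq hC.1 ht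
    (by simpa [hq.costate_zero, Costate.energy] using hC.2) (by linarith)
  simp only [hq.costate_zero] at h1 h2
  exact Costate.ext h1 h2 (hq.α_eq htt)

end EngelSpacelike

theorem mainTheorem10 : EngelSpacelike.MAX1 ∩ EngelSpacelike.N2 = ∅ := by
  rw [eq_empty_iff_forall_notMem]
  rintro ⟨l₀, t⟩ ⟨⟨hdom, hne, hExp⟩, hC, -⟩
  exact hne (EngelSpacelike.eps1Domain_fst_eq hdom hC hExp)
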